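/- **Lemma (Agreement, flattened protocols).** *System.* Enterprises own disjoint clusters of ordering nodes. A cluster $P$ either is crash-only and has $2f_P+1$ nodes, none of them malicious, or is Byzantine and has $3f_P+1$ nodes, at most $f_P$ of them malicious; its *local-majority* is $f_P+1$, respectively $2f_P+1$. The data collection $d_X$ shared by a set $X$ of enterprises is split into shards; every enterprise in $X$ maintains each shard of $d_X$ in exactly one of its clusters, and different shards in different clusters. The network is asynchronous and may lose, delay, duplicate and misroute messages; malicious nodes may send anything and may collude, but signatures cannot be forged and no two different requests or propose messages sent in the execution have the same digest. Any node may crash. Every node has its own view of who is the primary of each cluster, and these views may change at any time. *Identifiers.* A request $m$ accesses a set of shards of one data collection $d_X$; its *involved clusters* are the clusters that maintain these shards. For each of these shards the request gets an identifier $\langle\alpha,\gamma\rangle$ with local part $\alpha=[X{:}n]$ ($n\in\mathbb N$ a sequence number) and global part $\gamma$, which assigns sequence numbers to some collections $d_Y$ with $X\subsetneq Y$. The local ID of $m$ in an involved cluster $P$ is the local part of its identifier on the shard that $P$ maintains. A node regards an identifier as *valid* for $m$ if it has this form and, for every other request on $d_X$ for which the node has already assigned or accepted an identifier on its own shard, the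 two can be ordered so that the earlier one has the strictly smaller sequence number and, on every collection occurring in both global parts, a number that is not larger. *Protocols.* Consider the flattened protocols for intra-shard cross-enterprise, cross-shard intra-enterprise and cross-shard cross-enterprise requests. The primary of an involved cluster (the initiator) assigns a valid identifier on its shard and sends a propose message with the identifier, the request and its digest to all nodes of all involved clusters. For every other accessed shard, the primary of the cluster of the initiator enterprise that maintains it assigns a valid identifier and sends it to the nodes of all involved clusters that maintain this shard. (A primary assigns an identifier only if no other request that it is handling and has not committed intersects $m$ in two or more shards.) A node that receives a valid identifier for its own shard in this way sends an accept message, with this identifier, the initiator's identifier and the digest, to all nodes of all involved clusters. A node with matching accept messages from a local-majority of every involved cluster sends a commit message, with all identifiers and the digest, to all these nodes. A node with matching commit messages from a local-majority of every involved cluster (for intra-shard requests: matching its own commit message) commits the request. If the request is cross-shard intra-enterprise and all involved clusters are crash-only, then accept messages are sent only to the initiator primary, which, with matching accept messages from a local-majority of every involved cluster, sends the commit message, and a node commits on receiving it. Non-malicious nodes follow these rules until they crash. *Claim.* In every execution: if a non-malicious node $r$ commits request $m$ with local ID $\alpha$ in cluster $P$, then no non-malicious node (including $r$ itself) commits, at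 any time, a request $m'\neq m$ with the same local ID $\alpha$ in $P$. -/

import Mathlib

namespace Qanaat

universe u

/-! ### Enterprises, clusters, data collections -/

/-- How the (ordering) nodes of a cluster may fail. -/
inductive FailureModel where
  | crash
  | byzantine

/-- The static part of the system. A data collection is named by the set `X` of enterprises that
share it; it is split into the shards `shards X` (empty if the collection does not exist), and
all enterprises in `X` use this same sharding. Only the ordering nodes of a cluster are modelled:
they are the ones that run the consensus protocols (in a crash-only cluster they also execute). -/
structure Deployment where
  Enterprise : Type u
  Shard : Type u
  Cluster : Type u
  Node : Type u
  Client : Type u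
  Op : Type u
  Digest : Type u
  /-- the enterprise that owns a cluster -/
  owner : Cluster → Enterprise
  /-- the cluster of an ordering node -/
  clusterOf : Node → Cluster
  /-- the ordering nodes of a cluster -/
  nodes : Cluster → Finset Node
  mem_nodes : ∀ r P, r ∈ nodes P ↔ clusterOf r = P
  failure : Cluster → FailureModel
  /-- the number of faulty ordering nodes that a cluster is built to tolerate -/
  f : Cluster → ℕ
  card_nodes : ∀ P, (nodes P).card =
    match failure P with
    | .crash => 2 * f P + 1
    | .byzantine => 3 * f P + 1
  /-- the shards of the data collection shared by a set of enterprises -/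
  shards : Finset Enterprise → Finset Shard
  /-- `keeper X s e` is the cluster of enterprise `e ∈ X` that maintains shard `s` of the data
  collection of `X` -/
  keeper : Finset Enterprise → Shard → Enterprise → Cluster
  owner_keeper : ∀ X, ∀ s ∈ shards X, ∀ e ∈ X, owner (keeper X s e) = e
  /-- different clusters of an enterprise maintain different shards -/
  keeper_injective : ∀ X, ∀ e ∈ X, ∀ s ∈ shards X, ∀ t ∈ shards X,
    keeper X s e = keeper X t e → s = t

/-- The number of matching votes that is required from a cluster. -/
def Deployment.localMajority (D : Deployment.{u}) (P : D.Cluster) : ℕ :=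
  match D.failure P with
  | .crash => D.f P + 1
  | .byzantine => 2 * D.f P + 1

/-- Nodes of crash-only clusters are never malicious; among the `3 f + 1` ordering nodes of a
Byzantine cluster at most `f` are malicious. -/
def Deployment.WithinFaultBound (D : Deployment.{u}) (malicious : Set D.Node) : Prop :=
  ∀ P, match D.failure P with
    | .crash => ∀ r ∈ D.nodes P, r ∉ malicious
    | .byzantine => {r | r ∈ D.nodes P ∧ r ∈ malicious}.ncard ≤ D.f P

/-! ### Requests and transaction identifiers -/

/-- A (client-signed) request: an operation on some shards of one data collection. -/
structure Request (D : Deployment.{u}) where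
  op : D.Op
  time : ℕ
  client : D.Client
  coll : Finset D.Enterprise
  shards : Finset D.Shard

/-- The local part `[X : n]` of an identifier. -/
structure LocalId (D : Deployment.{u}) where
  label : Finset D.Enterprise
  seq : ℕ

/-- An identifier `⟨α, γ⟩`. The global part `γ` contains `Y : k` iff `glob Y = some k`. -/
structure TxId (D : Deployment.{u}) where
  loc : LocalId D
  glob : Finset D.Enterprise → Option ℕ

/-- The concatenation `[ID_i, ID_j, …]` of the identifiers of a request: one identifier for every
shard that the request accesses. In intra-shard transactions it has a single part. -/
abbrev IdVec (D : Deployment.{u}) := D.Shard → Option (TxId D)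

/-- The identifier vector has exactly one part for each accessed shard. -/
def IdVec.IsFor {D : Deployment.{u}} (ids : IdVec D) (m : Request D) : Prop :=
  ∀ s, (∃ i, ids s = some i) ↔ s ∈ m.shards

/-- `P` is the cluster that maintains shard `s` of the data collection of `m` for one of the
enterprises that share this collection. -/
def Keeps {D : Deployment.{u}} (P : D.Cluster) (m : Request D) (s : D.Shard) : Prop :=
  s ∈ m.shards ∧ D.owner P ∈ m.coll ∧ D.keeper m.coll s (D.owner P) = P

/-- The clusters that are involved in a request. -/
def Involved {D : Deployment.{u}} (m : Request D) (P : D.Cluster) : Prop :=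
  ∃ s, Keeps P m s

/-- The requests that the flattened protocols handle: those on existing shards of a data
collection that are intra-shard cross-enterprise, cross-shard intra-enterprise, or
cross-shard cross-enterprise. -/
def CrossCluster {D : Deployment.{u}} (m : Request D) : Prop :=
  m.shards ⊆ D.shards m.coll ∧
    ((m.shards.card = 1 ∧ 2 ≤ m.coll.card) ∨
     (2 ≤ m.shards.card ∧ m.coll.card = 1) ∨
     (2 ≤ m.shards.card ∧ 2 ≤ m.coll.card))

/-- The cross-shard intra-enterprise requests all of whose clusters are crash-only; they are
handled by the cheaper variant of the protocol, in which the initiator primary collects the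
votes. -/
def CrashOnly {D : Deployment.{u}} (m : Request D) : Prop :=
  2 ≤ m.shards.card ∧ m.coll.card = 1 ∧ ∀ P, Involved m P → D.failure P = .crash

/-- Two requests that intersect in at least two data shards. -/
def IntersectInTwo {D : Deployment.{u}} (m m' : Request D) : Prop :=
  m.coll = m'.coll ∧
    ∃ s t, s ≠ t ∧ s ∈ m.shards ∧ s ∈ m'.shards ∧ t ∈ m.shards ∧ t ∈ m'.shards

/-- `i` may precede `j`: if both are on the same data collection, then `i` has the smaller sequence
number (local consistency) and it captures no newer state of any other data collection (global
consistency). -/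
def MayPrecede {D : Deployment.{u}} (i j : TxId D) : Prop :=
  i.loc.label = j.loc.label →
    i.loc.seq < j.loc.seq ∧ ∀ Y k l, i.glob Y = some k → j.glob Y = some l → k ≤ l

/-- The log of a node: the digests of the requests that it has ordered or accepted, each with the
identifier of the request on the node's own shard. -/
abbrev Log (D : Deployment.{u}) := Set (D.Digest × TxId D)

/-- Validation of the identifier `i` for a request `m` with digest `d` by a node with log `L`:
`i` is an identifier on the data collection of `m`, its global part refers only to collections
that this collection is order-dependent on, and it can be ordered, by the rules of local and
global consistency, with respect to every other request in the log. -/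
def ValidId {D : Deployment.{u}} (L : Log D) (m : Request D) (d : D.Digest) (i : TxId D) : Prop :=
  i.loc.label = m.coll ∧
  (∀ Y k, i.glob Y = some k → m.coll ⊂ Y) ∧
  ∀ d' j, (d', j) ∈ L → d' ≠ d → MayPrecede i j ∨ MayPrecede j i

/-! ### Messages -/

/-- The contents of the messages that nodes sign. -/
inductive Body (D : Deployment.{u}) where
  /-- `⟨PROPOSE, ID_i, d, m⟩` -/
  | propose (idI : TxId D) (d : D.Digest) (m : Request D)
  /-- `⟨ACCEPT, ID_i, ID_j, d, d_μ⟩`, by which the primary of another cluster assigns `ID_j` -/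
  | assign (idI idJ : TxId D) (d dμ : D.Digest)
  /-- `⟨ACCEPT, ID_i, ID_j, d, r⟩`; in intra-shard transactions the two identifiers are the same -/
  | accept (idI idJ : TxId D) (d : D.Digest)
  /-- `⟨COMMIT, ID_i, ID_j, …, ID_k, d, r⟩` -/
  | commit (ids : IdVec D) (d : D.Digest)

/-- What travels on the network: requests signed by their clients and messages signed by nodes. -/
inductive Wire (D : Deployment.{u}) where
  | request (m : Request D)
  | signed (r : D.Node) (b : Body D)

/-- The things whose digest is used: requests, and signed propose messages. -/
inductive Hashable (D : Deployment.{u}) where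
  | request (m : Request D)
  | propose (q : D.Node) (idI : TxId D) (d : D.Digest) (m : Request D)

/-- A wire message together with its recipient. -/
abbrev Packet (D : Deployment.{u}) := D.Node × Wire D

/-- The packets by which node `r` sends `b` to all nodes in `dest`. -/
def multicast {D : Deployment.{u}} (dest : Set D.Node) (r : D.Node) (b : Body D) :
    Set (Packet D) :=
  {p | p.1 ∈ dest ∧ p.2 = .signed r b}

/-- All nodes of all clusters involved in `m`. -/
def involvedNodes {D : Deployment.{u}} (m : Request D) : Set D.Node :=
  {r | Involved m (D.clusterOf r)}

/-! ### States -/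

/-- The local state of a node. -/
structure NodeState (D : Deployment.{u}) where
  /-- the messages received so far -/
  inbox : Set (Wire D)
  /-- whom the node currently regards as the primary of each cluster -/
  primary : D.Cluster → D.Node
  log : Log D
  /-- the requests to which the node, as a primary, has assigned an identifier -/
  handled : Set (Request D)
  /-- the commit messages it has sent -/
  votes : Set (IdVec D × D.Digest)
  /-- the requests it has committed, with their identifiers -/
  committed : Set (Request D × IdVec D)

/-- A global state: the local states, all packets ever sent, and the nodes that have crashed. -/
structure State (D : Deployment.{u}) where
  node : D.Node → NodeState D
  net : Set (Packet D)
  crashed : Set D.Node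

open Classical in
/-- Node `r` moves to local state `L` and sends the packets `out`. -/
noncomputable def State.act {D : Deployment.{u}} (σ : State D) (r : D.Node) (L : NodeState D)
    (out : Set (Packet D)) : State D :=
  { σ with
    node := fun x => if x = r then L else σ.node x
    net := σ.net ∪ out }

/-- Nothing has happened yet; all nodes agree on the pre-elected primaries. -/
def Initial {D : Deployment.{u}} (σ : State D) : Prop :=
  σ.net = ∅ ∧ σ.crashed = ∅ ∧
  ∃ π : D.Cluster → D.Node, (∀ P, D.clusterOf (π P) = P) ∧
    ∀ r, σ.node r = ⟨∅, π, ∅, ∅, ∅, ∅⟩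

/-! ### Guards of the protocol steps -/

/-- `q` belongs to a cluster that maintains shard `s₀` of `m`, and a propose message for `m`,
signed by `q`, with a correct digest `d` and with identifier `idI` (on shard `s₀`), has been
received. -/
def GotPropose {D : Deployment.{u}} (hash : Hashable D → D.Digest) (inbox : Set (Wire D))
    (q : D.Node) (s₀ : D.Shard) (idI : TxId D) (d : D.Digest) (m : Request D) : Prop :=
  Wire.signed q (.propose idI d m) ∈ inbox ∧ d = hash (.request m) ∧ Keeps (D.clusterOf q) m s₀

/-- Matching messages `b` from a local-majority of cluster `P` have been received. -/
def GotQuorum {D : Deployment.{u}} (inbox : Set (Wire D)) (P : D.Cluster) (b : Body D) : Prop :=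
  ∃ Q : Finset D.Node, Q ⊆ D.nodes P ∧ D.localMajority P ≤ Q.card ∧
    ∀ q ∈ Q, Wire.signed q b ∈ inbox

/-- Matching accept messages from a local-majority of every involved cluster, where the cluster
that maintains shard `s` accepts the part of `ids` on `s`. -/
def GotAccepts {D : Deployment.{u}} (inbox : Set (Wire D)) (m : Request D) (idI : TxId D)
    (ids : IdVec D) (d : D.Digest) : Prop :=
  ∀ P s, Keeps P m s → ∃ idJ, ids s = some idJ ∧ GotQuorum inbox P (.accept idI idJ d)

/-- Matching commit messages from a local-majority of every involved cluster. -/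
def GotCommits {D : Deployment.{u}} (inbox : Set (Wire D)) (m : Request D)
    (ids : IdVec D) (d : D.Digest) : Prop :=
  ∀ P, Involved m P → GotQuorum inbox P (.commit ids d)

/-- No other request that `r` is handling as a primary and has not committed yet intersects `m`
in two shards. -/
def NoConcurrent {D : Deployment.{u}} (L : NodeState D) (m : Request D) : Prop :=
  ∀ m' ∈ L.handled, m' ≠ m → (∀ ids, (m', ids) ∉ L.committed) → ¬ IntersectInTwo m m'

/-- The recipients of the accept messages for `m`, proposed by `q`: all nodes of all involved
clusters, or only the initiator primary in the crash-only variant. -/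
def acceptDest {D : Deployment.{u}} (m : Request D) (q : D.Node) : Set D.Node :=
  {r | (CrashOnly m ∧ r = q) ∨ (¬ CrashOnly m ∧ r ∈ involvedNodes m)}

/-! ### The transition system -/

/-- One step of the system. The flattened protocols share the steps `propose`, `assign`,
`acceptSame` and `acceptOther`:
* in the intra-shard cross-enterprise protocol every involved cluster maintains the shard of the
  initiator cluster, so that every node accepts by `acceptSame`;
* in the cross-shard intra-enterprise protocol the primary of every other involved cluster
  assigns its own identifier by `assign`, and the nodes of its cluster accept by `acceptOther`;
* in the cross-shard cross-enterprise protocol identifiers are assigned only in the clusters of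
  the initiator enterprise, and the nodes of all clusters that maintain the same shard accept.

Then nodes vote and commit by `vote` and `decide`, or, in the crash-only variant, by `crashVote` and
`crashDecide`. The network is asynchronous: it may lose, delay, duplicate, reorder and misroute
messages, but signatures cannot be forged. Primaries may be replaced at any time. -/
inductive Step {D : Deployment.{u}} (hash : Hashable D → D.Digest) (malicious : Set D.Node) :
    State D → State D → Prop
  /-- A client (possibly a malicious one) sends a request to a node. -/
  | issue (σ : State D) (x : D.Node) (m : Request D) :
      Step hash malicious σ { σ with net := σ.net ∪ {(x, .request m)} }
  /-- A message that was sent is received by its recipient. -/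
  | deliver (σ : State D) (x : D.Node) (w : Wire D) (h : (x, w) ∈ σ.net) :
      Step hash malicious σ
        (σ.act x { σ.node x with inbox := (σ.node x).inbox ∪ {w} } ∅)
  /-- Retransmission, forwarding or misrouting of a message that was sent. -/
  | replay (σ : State D) (x y : D.Node) (w : Wire D) (h : (x, w) ∈ σ.net) :
      Step hash malicious σ { σ with net := σ.net ∪ {(y, w)} }
  /-- A malicious node sends anything, under its own signature. -/
  | forge (σ : State D) (b x : D.Node) (c : Body D) (hb : b ∈ malicious) :
      Step hash malicious σ { σ with net := σ.net ∪ {(x, .signed b c)} }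
  /-- A malicious node changes its local state arbitrarily. -/
  | corrupt (σ : State D) (b : D.Node) (L : NodeState D) (hb : b ∈ malicious) :
      Step hash malicious σ (σ.act b L ∅)
  /-- A node crashes. -/
  | crash (σ : State D) (r : D.Node) :
      Step hash malicious σ { σ with crashed := σ.crashed ∪ {r} }
  /-- A node learns that the primary of a cluster has been replaced. -/
  | elect (σ : State D) (r : D.Node) (L : NodeState D) (P : D.Cluster)
      (hr : r ∉ malicious) (hc : r ∉ σ.crashed)
      (hP : D.clusterOf (L.primary P) = P)
      (hL : L = { σ.node r with primary := L.primary })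
      (hsame : ∀ P', P' ≠ P → L.primary P' = (σ.node r).primary P') :
      Step hash malicious σ (σ.act r L ∅)
  /-- The primary `q` of the initiator cluster, which maintains shard `s₀`, assigns the identifier
  `idI` to the request and proposes it to all nodes of all involved clusters. -/
  | propose (σ : State D) (q : D.Node) (s₀ : D.Shard) (idI : TxId D) (m : Request D)
      (hq : q ∉ malicious) (hc : q ∉ σ.crashed)
      (hm : CrossCluster m) (hs : Keeps (D.clusterOf q) m s₀)
      (hreq : Wire.request m ∈ (σ.node q).inbox)
      (hprim : (σ.node q).primary (D.clusterOf q) = q)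
      (hid : ValidId (σ.node q).log m (hash (.request m)) idI)
      (hcon : NoConcurrent (σ.node q) m) :
      Step hash malicious σ
        (σ.act q
          { σ.node q with
            log := (σ.node q).log ∪ {(hash (.request m), idI)}
            handled := (σ.node q).handled ∪ {m} }
          (multicast (involvedNodes m) q (.propose idI (hash (.request m)) m)))
  /-- The primary `p` of another cluster of the initiator enterprise, which maintains shard
  `s ≠ s₀`, assigns the identifier `idJ` to the proposed request, and sends it to the nodes of all
  involved clusters that maintain the shard `s`. -/
  | assign (σ : State D) (p q : D.Node) (s₀ s : D.Shard) (idI idJ : TxId D) (d : D.Digest)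
      (m : Request D)
      (hp : p ∉ malicious) (hc : p ∉ σ.crashed)
      (hm : CrossCluster m)
      (hprop : GotPropose hash (σ.node p).inbox q s₀ idI d m)
      (hlabel : idI.loc.label = m.coll)
      (hlead : (σ.node p).primary (D.clusterOf q) = q)
      (hs : Keeps (D.clusterOf p) m s) (hne : s ≠ s₀)
      (howner : D.owner (D.clusterOf p) = D.owner (D.clusterOf q))
      (hprim : (σ.node p).primary (D.clusterOf p) = p)
      (hid : ValidId (σ.node p).log m d idJ)
      (hcon : NoConcurrent (σ.node p) m) :
      Step hash malicious σ
        (σ.act p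
          { σ.node p with
            log := (σ.node p).log ∪ {(d, idJ)}
            handled := (σ.node p).handled ∪ {m} }
          (multicast {r | Keeps (D.clusterOf r) m s} p
            (.assign idI idJ d (hash (.propose q idI d m)))))
  /-- A node whose cluster maintains the same shard as the initiator cluster accepts the
  proposal of the initiator primary. -/
  | acceptSame (σ : State D) (r q : D.Node) (s₀ : D.Shard) (idI : TxId D) (d : D.Digest)
      (m : Request D)
      (hr : r ∉ malicious) (hc : r ∉ σ.crashed)
      (hm : CrossCluster m)
      (hprop : GotPropose hash (σ.node r).inbox q s₀ idI d m)
      (hlead : (σ.node r).primary (D.clusterOf q) = q)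
      (hs : Keeps (D.clusterOf r) m s₀)
      (hid : ValidId (σ.node r).log m d idI) :
      Step hash malicious σ
        (σ.act r
          { σ.node r with log := (σ.node r).log ∪ {(d, idI)} }
          (multicast (acceptDest m q) r (.accept idI idI d)))
  /-- A node whose cluster maintains another shard `s` accepts the proposal, with the identifier
  assigned by the primary `p` of the cluster of the initiator enterprise that maintains `s`. -/
  | acceptOther (σ : State D) (r q p : D.Node) (s₀ s : D.Shard) (idI idJ : TxId D) (d : D.Digest)
      (m : Request D)
      (hr : r ∉ malicious) (hc : r ∉ σ.crashed)
      (hm : CrossCluster m)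
      (hprop : GotPropose hash (σ.node r).inbox q s₀ idI d m)
      (hlabel : idI.loc.label = m.coll)
      (hlead : (σ.node r).primary (D.clusterOf q) = q)
      (hs : Keeps (D.clusterOf r) m s) (hne : s ≠ s₀)
      (hp : Keeps (D.clusterOf p) m s)
      (howner : D.owner (D.clusterOf p) = D.owner (D.clusterOf q))
      (hplead : (σ.node r).primary (D.clusterOf p) = p)
      (hassign : Wire.signed p (.assign idI idJ d (hash (.propose q idI d m))) ∈
        (σ.node r).inbox)
      (hid : ValidId (σ.node r).log m d idJ) :
      Step hash malicious σ
        (σ.act r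
          { σ.node r with log := (σ.node r).log ∪ {(d, idJ)} }
          (multicast (acceptDest m q) r (.accept idI idJ d)))
  /-- A node that has matching accept messages from a local-majority of every involved cluster
  multicasts a commit message. -/
  | vote (σ : State D) (r q : D.Node) (s₀ : D.Shard) (idI : TxId D) (ids : IdVec D)
      (d : D.Digest) (m : Request D)
      (hr : r ∉ malicious) (hc : r ∉ σ.crashed)
      (hm : CrossCluster m) (hcrash : ¬ CrashOnly m)
      (hinv : Involved m (D.clusterOf r))
      (hprop : GotPropose hash (σ.node r).inbox q s₀ idI d m)
      (hids : ids.IsFor m) (hids₀ : ids s₀ = some idI)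
      (hacc : GotAccepts (σ.node r).inbox m idI ids d) :
      Step hash malicious σ
        (σ.act r { σ.node r with votes := (σ.node r).votes ∪ {(ids, d)} }
          (multicast (involvedNodes m) r (.commit ids d)))
  /-- A node that has matching commit messages from a local-majority of every involved cluster
  (in intra-shard transactions: which match its own commit message) commits the request. -/
  | decide (σ : State D) (r q : D.Node) (s₀ : D.Shard) (idI : TxId D) (ids : IdVec D)
      (d : D.Digest) (m : Request D)
      (hr : r ∉ malicious) (hc : r ∉ σ.crashed)
      (hm : CrossCluster m) (hcrash : ¬ CrashOnly m)
      (hinv : Involved m (D.clusterOf r))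
      (hprop : GotPropose hash (σ.node r).inbox q s₀ idI d m)
      (hids : ids.IsFor m) (hids₀ : ids s₀ = some idI)
      (hcom : GotCommits (σ.node r).inbox m ids d)
      (hown : m.shards.card = 1 → (ids, d) ∈ (σ.node r).votes) :
      Step hash malicious σ
        (σ.act r { σ.node r with committed := (σ.node r).committed ∪ {(m, ids)} } ∅)
  /-- Crash-only variant: the initiator primary, having matching accept messages from a
  local-majority of every involved cluster, multicasts a commit message. -/
  | crashVote (σ : State D) (q : D.Node) (s₀ : D.Shard) (idI : TxId D) (ids : IdVec D)
      (d : D.Digest) (m : Request D)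
      (hq : q ∉ malicious) (hc : q ∉ σ.crashed)
      (hm : CrossCluster m) (hcrash : CrashOnly m)
      (hprop : GotPropose hash (σ.node q).inbox q s₀ idI d m)
      (hprim : (σ.node q).primary (D.clusterOf q) = q)
      (hids : ids.IsFor m) (hids₀ : ids s₀ = some idI)
      (hacc : GotAccepts (σ.node q).inbox m idI ids d) :
      Step hash malicious σ
        (σ.act q { σ.node q with votes := (σ.node q).votes ∪ {(ids, d)} }
          (multicast (involvedNodes m) q (.commit ids d)))
  /-- Crash-only variant: a node commits when it has a commit message of the initiator primary. -/
  | crashDecide (σ : State D) (r q : D.Node) (s₀ : D.Shard) (idI : TxId D) (ids : IdVec D)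
      (d : D.Digest) (m : Request D)
      (hr : r ∉ malicious) (hc : r ∉ σ.crashed)
      (hm : CrossCluster m) (hcrash : CrashOnly m)
      (hinv : Involved m (D.clusterOf r))
      (hprop : GotPropose hash (σ.node r).inbox q s₀ idI d m)
      (hlead : (σ.node r).primary (D.clusterOf q) = q)
      (hids : ids.IsFor m) (hids₀ : ids s₀ = some idI)
      (hcom : Wire.signed q (.commit ids d) ∈ (σ.node r).inbox) :
      Step hash malicious σ
        (σ.act r { σ.node r with committed := (σ.node r).committed ∪ {(m, ids)} } ∅)

/-- The states that occur in executions. -/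
def Reachable {D : Deployment.{u}} (hash : Hashable D → D.Digest) (malicious : Set D.Node)
    (σ : State D) : Prop :=
  ∃ σ₀, Initial σ₀ ∧ Relation.ReflTransGen (Step hash malicious) σ₀ σ

/-! ### Digests, commits -/

/-- The requests and propose messages that have been sent. -/
inductive Occurs {D : Deployment.{u}} (σ : State D) : Hashable D → Prop
  | request (x : D.Node) (m : Request D) (h : (x, .request m) ∈ σ.net) :
      Occurs σ (.request m)
  | proposedRequest (x q : D.Node) (idI : TxId D) (d : D.Digest) (m : Request D)
      (h : (x, .signed q (.propose idI d m)) ∈ σ.net) : Occurs σ (.request m)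
  | propose (x q : D.Node) (idI : TxId D) (d : D.Digest) (m : Request D)
      (h : (x, .signed q (.propose idI d m)) ∈ σ.net) : Occurs σ (.propose q idI d m)

/-- Collision resistance of the hash function, as far as it concerns one execution: nobody has
sent two different requests or propose messages with the same digest. -/
def CollisionFree {D : Deployment.{u}} (hash : Hashable D → D.Digest) (σ : State D) : Prop :=
  ∀ a b, Occurs σ a → Occurs σ b → hash a = hash b → a = b

/-- Node `r` has committed request `m` with local identifier `α` in the involved cluster `P`, that
is, `α` is the local part of the identifier of `m` on the shard that `P` maintains. -/
def CommitsIn {D : Deployment.{u}} (σ : State D) (r : D.Node) (m : Request D) (α : LocalId D)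
    (P : D.Cluster) : Prop :=
  ∃ ids s i, (m, ids) ∈ (σ.node r).committed ∧ Keeps P m s ∧ ids s = some i ∧ i.loc = α

end Qanaat

namespace Qanaat

universe u

variable {D : Deployment.{u}} {hash : Hashable D → D.Digest} {malicious : Set D.Node}
  {σ σ' : State D}

/-! Safety rests on quorum intersection in the single cluster `P`; who proposed or assigned an
identifier, and whom the nodes regard as primary, plays no role. A commit by a correct node traces
back to a commit message of some correct node, and that node had seen accept messages for the
identifier on `P`'s shard from a local-majority of `P`. Two commits in `P` thus give two
local-majorities of `P`, which share a correct node (`quorums_intersect_correct`). That node logged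
both identifiers when it accepted them.

A correct node validates each identifier against its whole log before adding it, so any two entries
with different digests can be ordered, with strictly increasing sequence numbers on a common
collection. Different requests have different digests, so their local IDs cannot coincide.

The history behind a commit is kept in `Invariant`, proved by induction over steps. Collision
freeness is applied only to the final state, so the invariant speaks of some request with the signed
digest, and `Invariant.acceptedEverywhere` identifies that request afterwards. -/

/-- Node `v` has signed and sent a message with contents `b`. -/
def Sent (σ : State D) (v : D.Node) (b : Body D) : Prop :=
  ∃ x, (x, Wire.signed v b) ∈ σ.net

/-- A local-majority of cluster `P` has sent messages `b`. -/
def SentQuorum (σ : State D) (P : D.Cluster) (b : Body D) : Prop :=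
  ∃ Q : Finset D.Node, Q ⊆ D.nodes P ∧ D.localMajority P ≤ Q.card ∧ ∀ q ∈ Q, Sent σ q b

/-- The identifiers `ids` of the request `m` have been accepted by a local-majority of every
involved cluster. -/
def AcceptedEverywhere (σ : State D) (m : Request D) (ids : IdVec D) (d : D.Digest) : Prop :=
  ∀ P s, Keeps P m s → ∃ idI idJ, ids s = some idJ ∧ SentQuorum σ P (.accept idI idJ d)

/-! ### Consistency of logs -/

/-- Two different requests in the log can be ordered. -/
def Log.Consistent (L : Log D) : Prop :=
  ∀ d i d' i', (d, i) ∈ L → (d', i') ∈ L → d ≠ d' → MayPrecede i i' ∨ MayPrecede i' i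

/-- The last clause of `ValidId` compares the new entry with all old entries of another digest.
Entries with the same digest are never compared, so a request may be logged repeatedly with
different identifiers. -/
theorem Log.Consistent.insert {L : Log D} (hL : L.Consistent) {m : Request D} {d : D.Digest}
    {i : TxId D} (h : ValidId L m d i) : Log.Consistent (L ∪ {(d, i)}) := by
  have h2 := h.2.2
  rintro d₁ i₁ d₂ i₂ (h₁ | h₁) (h₂ | h₂) hne
  · exact hL _ _ _ _ h₁ h₂ hne
  · obtain ⟨rfl, rfl⟩ := Prod.mk.inj h₂
    exact (h2 _ _ h₁ hne).symm
  · obtain ⟨rfl, rfl⟩ := Prod.mk.inj h₁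
    exact h2 _ _ h₂ hne.symm
  · obtain ⟨rfl, rfl⟩ := Prod.mk.inj h₁
    obtain ⟨rfl, rfl⟩ := Prod.mk.inj h₂
    exact absurd rfl hne

/-! ### What a single step preserves and what it can add -/

theorem Step.net_subset (h : Step hash malicious σ σ') : σ.net ⊆ σ'.net := by
  cases h <;> simp [State.act]

theorem Step.sent (h : Step hash malicious σ σ') {v : D.Node} {b : Body D} (hs : Sent σ v b) :
    Sent σ' v b :=
  hs.imp fun _ hx => h.net_subset hx

theorem Step.sentQuorum (h : Step hash malicious σ σ') {P : D.Cluster} {b : Body D}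
    (hs : SentQuorum σ P b) : SentQuorum σ' P b := by
  obtain ⟨Q, hQ, hc, hq⟩ := hs
  exact ⟨Q, hQ, hc, fun q h' => h.sent (hq q h')⟩

theorem Step.acceptedEverywhere (h : Step hash malicious σ σ') {m : Request D} {ids : IdVec D}
    {d : D.Digest} (ha : AcceptedEverywhere σ m ids d) : AcceptedEverywhere σ' m ids d := by
  intro P s hk
  obtain ⟨idI, idJ, hi, hq⟩ := ha P s hk
  exact ⟨idI, idJ, hi, h.sentQuorum hq⟩

theorem Step.occurs (h : Step hash malicious σ σ') {a : Hashable D} (ha : Occurs σ a) :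
    Occurs σ' a := by
  cases ha with
  | request x m hx => exact .request x m (h.net_subset hx)
  | proposedRequest x q idI d m hx => exact .proposedRequest x q idI d m (h.net_subset hx)
  | propose x q idI d m hx => exact .propose x q idI d m (h.net_subset hx)

/-- Only `deliver` adds to the inbox of a correct node, and it needs a packet on the network;
`corrupt` could fill an inbox arbitrarily, hence the restriction on `r`. -/
theorem Step.inbox (h : Step hash malicious σ σ') {r : D.Node} (hr : r ∉ malicious) {w : Wire D}
    (hw : w ∈ (σ'.node r).inbox) : w ∈ (σ.node r).inbox ∨ (r, w) ∈ σ.net := by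
  cases h <;> simp only [State.act] at hw <;> grind

theorem Step.log_subset (h : Step hash malicious σ σ') {r : D.Node} (hr : r ∉ malicious) :
    (σ.node r).log ⊆ (σ'.node r).log := by
  cases h <;> simp only [State.act] <;> grind

theorem Step.log_consistent (h : Step hash malicious σ σ') {r : D.Node} (hr : r ∉ malicious)
    (hL : (σ.node r).log.Consistent) : (σ'.node r).log.Consistent := by
  cases h <;> simp only [State.act] <;> (try split_ifs) <;>
    first
      | exact hL
      | (subst_vars; first | exact hL | exact hL.insert ‹_› | contradiction)
      | grind

/-- Both accepting steps write the identifier to the log in the same step in which they send the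
message, so the log is taken after the step. -/
theorem Step.accept (h : Step hash malicious σ σ') {r : D.Node} (hr : r ∉ malicious)
    {idI idJ : TxId D} {d : D.Digest} (hs : Sent σ' r (.accept idI idJ d)) :
    Sent σ r (.accept idI idJ d) ∨ (d, idJ) ∈ (σ'.node r).log := by
  obtain ⟨x, hx⟩ := hs
  cases h <;> simp only [State.act, multicast] at hx ⊢ <;> grind [Sent]

/-- The guard under which a node sends a commit message. -/
theorem Step.commit (h : Step hash malicious σ σ') {r : D.Node} (hr : r ∉ malicious)
    {ids : IdVec D} {d : D.Digest} (hs : Sent σ' r (.commit ids d)) :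
    Sent σ r (.commit ids d) ∨ ∃ q s₀ idI m, GotPropose hash (σ.node r).inbox q s₀ idI d m ∧
      GotAccepts (σ.node r).inbox m idI ids d := by
  obtain ⟨x, hx⟩ := hs
  cases h <;> simp only [State.act, multicast] at hx ⊢ <;> grind [Sent]

/-- The guards under which a node commits a request. -/
theorem Step.committed (h : Step hash malicious σ σ') {r : D.Node} (hr : r ∉ malicious)
    {m : Request D} {ids : IdVec D} (hs : (m, ids) ∈ (σ'.node r).committed) :
    (m, ids) ∈ (σ.node r).committed ∨
      ∃ q s₀ idI d, GotPropose hash (σ.node r).inbox q s₀ idI d m ∧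
        (Involved m (D.clusterOf r) ∧ GotCommits (σ.node r).inbox m ids d ∨
          CrashOnly m ∧ Wire.signed q (.commit ids d) ∈ (σ.node r).inbox) := by
  cases h <;> simp only [State.act] at hs <;> grind

/-! ### Counting in quorums -/

/-- The threshold depends on the failure model: any node of a crash-only cluster will do, while in a
Byzantine cluster the set must outnumber the at most `f` malicious nodes. -/
theorem exists_not_mem_malicious (hfault : D.WithinFaultBound malicious) {P : D.Cluster}
    {Q : Finset D.Node} (hQ : Q ⊆ D.nodes P)
    (hcard : D.failure P = .crash → 0 < Q.card)
    (hcard' : D.failure P = .byzantine → D.f P < Q.card) : ∃ q ∈ Q, q ∉ malicious := by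
  have hP := hfault P
  by_contra! hmal
  cases hf : D.failure P with
  | crash =>
    rw [hf] at hP
    obtain ⟨q, hq⟩ := Finset.card_pos.mp (hcard hf)
    exact hP q (hQ hq) (hmal q hq)
  | byzantine =>
    rw [hf] at hP
    have hfin : {r | r ∈ D.nodes P ∧ r ∈ malicious}.Finite :=
      (D.nodes P).finite_toSet.subset fun _ h => h.1
    have hsub : (Q : Set D.Node) ⊆ {r | r ∈ D.nodes P ∧ r ∈ malicious} :=
      fun q hq => ⟨hQ hq, hmal q hq⟩
    have hle := Set.ncard_le_ncard hsub hfin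
    rw [Set.ncard_coe_finset] at hle
    have := hcard' hf
    simp only at hP
    omega

theorem quorum_exists_correct (hfault : D.WithinFaultBound malicious) {P : D.Cluster}
    {Q : Finset D.Node} (hQ : Q ⊆ D.nodes P) (hcard : D.localMajority P ≤ Q.card) :
    ∃ q ∈ Q, q ∉ malicious := by
  apply exists_not_mem_malicious hfault hQ <;> intro hf <;>
    simp only [Deployment.localMajority, hf] at hcard <;> omega

open Classical in
theorem quorums_intersect_correct (hfault : D.WithinFaultBound malicious) {P : D.Cluster}
    {Q Q' : Finset D.Node} (hQ : Q ⊆ D.nodes P) (hQ' : Q' ⊆ D.nodes P)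
    (hcard : D.localMajority P ≤ Q.card) (hcard' : D.localMajority P ≤ Q'.card) :
    ∃ q ∈ Q, q ∈ Q' ∧ q ∉ malicious := by
  have hn := D.card_nodes P
  have hun := Finset.card_le_card (Finset.union_subset hQ hQ')
  have hadd := Finset.card_union_add_card_inter Q Q'
  -- By inclusion-exclusion the overlap has at least `2(f+1) - (2f+1) = 1` node in a crash-only
  -- cluster and `2(2f+1) - (3f+1) = f+1` nodes in a Byzantine one, which is just enough in each
  -- case.
  obtain ⟨q, hq, hmal⟩ := exists_not_mem_malicious (Q := Q ∩ Q') hfault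
    (Finset.inter_subset_left.trans hQ)
    (fun hf => by
      replace hn : (D.nodes P).card = 2 * D.f P + 1 := by rw [hn, hf]
      simp only [Deployment.localMajority, hf] at hcard hcard'
      omega)
    (fun hf => by
      replace hn : (D.nodes P).card = 3 * D.f P + 1 := by rw [hn, hf]
      simp only [Deployment.localMajority, hf] at hcard hcard'
      omega)
  exact ⟨q, (Finset.mem_inter.mp hq).1, (Finset.mem_inter.mp hq).2, hmal⟩

/-! ### The invariant of reachable states -/

/-- The facts about non-malicious nodes that hold in all reachable states. -/
structure Invariant (hash : Hashable D → D.Digest) (malicious : Set D.Node) (σ : State D) :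
    Prop where
  inbox : ∀ r ∉ malicious, ∀ w ∈ (σ.node r).inbox, (r, w) ∈ σ.net
  log : ∀ r ∉ malicious, (σ.node r).log.Consistent
  accept : ∀ r ∉ malicious, ∀ idI idJ d, Sent σ r (.accept idI idJ d) → (d, idJ) ∈ (σ.node r).log
  commit : ∀ r ∉ malicious, ∀ ids d, Sent σ r (.commit ids d) →
    ∃ m, d = hash (.request m) ∧ Occurs σ (.request m) ∧ AcceptedEverywhere σ m ids d
  committed : ∀ r ∉ malicious, ∀ m ids, (m, ids) ∈ (σ.node r).committed →
    Occurs σ (.request m) ∧ ∃ v ∉ malicious, Sent σ v (.commit ids (hash (.request m)))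

theorem Initial.invariant (h : Initial σ) : Invariant hash malicious σ := by
  obtain ⟨hnet, -, π, -, hnode⟩ := h
  constructor <;> simp [hnode, Sent, hnet, Log.Consistent]

theorem GotPropose.occurs (hI : Invariant hash malicious σ) {r : D.Node} (hr : r ∉ malicious)
    {q : D.Node} {s₀ : D.Shard} {idI : TxId D} {d : D.Digest} {m : Request D}
    (h : GotPropose hash (σ.node r).inbox q s₀ idI d m) : Occurs σ (.request m) :=
  .proposedRequest r q idI d m (hI.inbox r hr _ h.1)

theorem GotQuorum.sent (hI : Invariant hash malicious σ) {r : D.Node} (hr : r ∉ malicious)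
    {P : D.Cluster} {b : Body D} (h : GotQuorum (σ.node r).inbox P b) : SentQuorum σ P b := by
  obtain ⟨Q, hQ, hc, hq⟩ := h
  exact ⟨Q, hQ, hc, fun q h' => ⟨r, hI.inbox r hr _ (hq q h')⟩⟩

/-- Facts about the past survive because the network and the logs of correct nodes only grow; a new
message or commit inherits its justification from the guard of its step, since everything in a
correct inbox was really sent. -/
theorem Invariant.step (hfault : D.WithinFaultBound malicious) (hI : Invariant hash malicious σ)
    (h : Step hash malicious σ σ') : Invariant hash malicious σ' where
  inbox r hr w hw :=
    h.net_subset ((h.inbox hr hw).elim (hI.inbox r hr w) id)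
  log r hr := h.log_consistent hr (hI.log r hr)
  accept r hr idI idJ d hs :=
    (h.accept hr hs).elim (fun h' => h.log_subset hr (hI.accept r hr _ _ _ h')) id
  commit r hr ids d hs := by
    obtain h' | ⟨q, s₀, idI, m, hp, ha⟩ := h.commit hr hs
    · obtain ⟨m, hd, ho, ha⟩ := hI.commit r hr _ _ h'
      exact ⟨m, hd, h.occurs ho, h.acceptedEverywhere ha⟩
    · refine ⟨m, hp.2.1, h.occurs (hp.occurs hI hr), fun P s hk => ?_⟩
      obtain ⟨idJ, hi, hq⟩ := ha P s hk
      exact ⟨idI, idJ, hi, h.sentQuorum (hq.sent hI hr)⟩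
  committed r hr m ids hs := by
    obtain h' | ⟨q, s₀, idI, d, hp, h'⟩ := h.committed hr hs
    · obtain ⟨ho, v, hv, hsv⟩ := hI.committed r hr _ _ h'
      exact ⟨h.occurs ho, v, hv, h.sent hsv⟩
    · refine ⟨h.occurs (hp.occurs hI hr), ?_⟩
      obtain ⟨hin, rfl, hk⟩ := hp
      obtain ⟨hinv, hc⟩ | ⟨hc, hq⟩ := h'
      -- One quorum suffices to find a correct voter; that of the node's own cluster is at hand,
      -- because this cluster is involved.
      · obtain ⟨Q, hQ, hcard, hsent⟩ := (hc _ hinv).sent hI hr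
        obtain ⟨v, hvQ, hv⟩ := quorum_exists_correct hfault hQ hcard
        exact ⟨v, hv, h.sent (hsent v hvQ)⟩
      -- In the crash-only variant a single commit message decides, but its signer belongs to an
      -- involved, hence crash-only, cluster and so is not malicious.
      · have hq' := hfault (D.clusterOf q)
        rw [hc.2.2 _ ⟨s₀, hk⟩] at hq'
        exact ⟨q, hq' q ((D.mem_nodes _ _).mpr rfl), h.sent ⟨r, hI.inbox r hr _ hq⟩⟩

theorem Reachable.invariant (hfault : D.WithinFaultBound malicious)
    (h : Reachable hash malicious σ) : Invariant hash malicious σ := by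
  obtain ⟨σ₀, h₀, hsteps⟩ := h
  induction hsteps with
  | refl => exact h₀.invariant
  | tail _ hstep ih => exact ih.step hfault hstep

/-- A commit message carries only a digest, so its sender may have had another request in mind; both
requests occur in the execution, and collision freeness makes them equal. -/
theorem Invariant.acceptedEverywhere (hI : Invariant hash malicious σ)
    (hhash : CollisionFree hash σ) {r : D.Node} (hr : r ∉ malicious) {m : Request D}
    {ids : IdVec D} (h : (m, ids) ∈ (σ.node r).committed) :
    AcceptedEverywhere σ m ids (hash (.request m)) := by
  obtain ⟨ho, v, hv, hs⟩ := hI.committed r hr _ _ h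
  obtain ⟨m', hd, ho', ha⟩ := hI.commit v hv _ _ hs
  obtain rfl : m = m' := Hashable.request.inj (hhash _ _ ho ho' hd)
  exact ha

/-- Equal labels activate the ordering condition, whose strict inequality of sequence numbers then
fails. -/
theorem not_mayPrecede_of_loc_eq {i j : TxId D} (h : i.loc = j.loc) : ¬ MayPrecede i j :=
  fun hp => (hp (by rw [h])).1.ne (by rw [h])

end Qanaat

/-- Agreement for the flattened consensus protocols. Nodes that have crashed after committing are
covered too: only malicious nodes are excluded. -/
theorem mainTheorem5 (D : Qanaat.Deployment) (hash : Qanaat.Hashable D → D.Digest)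
    (malicious : Set D.Node) (hfault : D.WithinFaultBound malicious)
    (σ : Qanaat.State D) (hσ : Qanaat.Reachable hash malicious σ)
    (hhash : Qanaat.CollisionFree hash σ)
    (P : D.Cluster) (α : Qanaat.LocalId D)
    (r r' : D.Node) (hr : r ∉ malicious) (hr' : r' ∉ malicious)
    (m m' : Qanaat.Request D) (hne : m ≠ m')
    (hcommit : Qanaat.CommitsIn σ r m α P) :
    ¬ Qanaat.CommitsIn σ r' m' α P := by
  rintro ⟨ids', s', i', hmem', hk', hi', hloc'⟩
  obtain ⟨ids, s, i, hmem, hk, hi, hloc⟩ := hcommit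
  have hI := hσ.invariant hfault
  obtain ⟨idI, j, hj, Q, hQ, hcard, hsent⟩ := hI.acceptedEverywhere hhash hr hmem P s hk
  obtain ⟨idI', j', hj', Q', hQ', hcard', hsent'⟩ :=
    hI.acceptedEverywhere hhash hr' hmem' P s' hk'
  obtain rfl : i = j := Option.some.inj (hi.symm.trans hj)
  obtain rfl : i' = j' := Option.some.inj (hi'.symm.trans hj')
  -- The shards `s` and `s'` need not be compared: `x` keeps one log, which contains both accepted
  -- identifiers.
  obtain ⟨x, hx, hx', hmal⟩ := Qanaat.quorums_intersect_correct hfault hQ hQ' hcard hcard'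
  have hd : hash (.request m) ≠ hash (.request m') := fun h => hne
    (Qanaat.Hashable.request.inj
      (hhash _ _ (hI.committed r hr _ _ hmem).1 (hI.committed r' hr' _ _ hmem').1 h))
  have hll : i.loc = i'.loc := hloc.trans hloc'.symm
  exact (hI.log x hmal _ _ _ _ (hI.accept x hmal _ _ _ (hsent x hx))
    (hI.accept x hmal _ _ _ (hsent' x hx')) hd).elim
    (Qanaat.not_mayPrecede_of_loc_eq hll) (Qanaat.not_mayPrecede_of_loc_eq hll.symm)
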